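/- Let $d\ge 2$ be an integer and $\omega=e^{2\pi i/d}$, and index the rows and columns of $d\times d$ matrices by $\mathbb{Z}_d$. Let $S$ be the cyclic shift matrix, $S_{jk}=\delta_{j,k+1}$, and $\Omega$ the modulation matrix, $\Omega_{jk}=\omega^{j}\delta_{jk}$. Let $T:\mathbb{C}^{\mathbb{Z}_d\times\mathbb{Z}_d}\to\mathbb{C}^{\mathbb{Z}_d\times\mathbb{Z}_d}$ be the linear operator (the reconstruction operator, or projective Fourier transform of $\mathbb{Z}_d\times\mathbb{Z}_d$) given by $$Tc=\frac1d\sum_{j,k\in\mathbb{Z}_d}c_{jk}\,(S^j\Omega^k)^*,$$ where $^*$ denotes the conjugate transpose. Then $\sqrt d\,T$ has finite order; more precisely, $$(\sqrt d\,T)^{6d}=(-1)^{\frac12 d(d-1)}I,$$ where powers are taken under composition and $I$ is the identity operator. -/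

import Mathlib

open scoped Matrix

noncomputable section

namespace WeylHeisenberg

/-- The primitive `d`-th root of unity `ω = exp (2πi/d)`. -/
def omega (d : ℕ) : ℂ := Complex.exp (2 * Real.pi * Complex.I / d)

/-- The cyclic shift matrix, `S j k = δ_{j, k+1}`, with indices in `ℤ_d`. -/
def shift (d : ℕ) : Matrix (ZMod d) (ZMod d) ℂ :=
  Matrix.of fun j k => if j = k + 1 then 1 else 0

/-- The modulation matrix, `Ω j k = ω^j δ_{j, k}`, with indices in `ℤ_d`. Since `ω^d = 1`,
the power `ω^j` may be computed with the representative `j.val` of `j`. -/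
def modulation (d : ℕ) : Matrix (ZMod d) (ZMod d) ℂ :=
  Matrix.diagonal fun j => omega d ^ j.val

/-- The unitary matrices `ρ (j, k) = S^j Ω^k` of the projective representation of `ℤ_d × ℤ_d`.
Since `S^d = Ω^d = 1`, the powers may be computed with the representatives `j.val`, `k.val`. -/
def rho (d : ℕ) [NeZero d] (g : ZMod d × ZMod d) : Matrix (ZMod d) (ZMod d) ℂ :=
  shift d ^ g.1.val * modulation d ^ g.2.val

/-- The reconstruction operator (the projective Fourier transform of `ℤ_d × ℤ_d`):
the linear operator `T c = (1/d) ∑_{j,k} c_{jk} (S^j Ω^k)^*` on `ℂ^{ℤ_d × ℤ_d}`. -/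
def reconstruction (d : ℕ) [NeZero d] : Module.End ℂ (Matrix (ZMod d) (ZMod d) ℂ) where
  toFun c := (1 / (d : ℂ)) • ∑ j : ZMod d, ∑ k : ZMod d, c j k • (rho d (j, k))ᴴ
  map_add' c c' := by
    simp only [Matrix.add_apply, add_smul, Finset.sum_add_distrib, smul_add]
  map_smul' a c := by
    simp only [Matrix.smul_apply, smul_eq_mul, mul_smul, ← Finset.smul_sum, RingHom.id_apply]
    rw [smul_comm]

end WeylHeisenberg

end

/-! The cube of the operator collapses to a single sum, and quadratic chirps diagonalise what
remains: by `reconstruction_pow_six_chirpPacket`, the sixth power fixes the frequency `k` and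
multiplies column `b` by `g ^ 2 / d ^ 4` times a `d`-th root of unity, where `g = chirpSum d`.
Raising to the power `d` leaves only a scalar, and chirp packets span by `exists_sum_chirpPacket`.
It remains to find `g ^ (2 * d)`. This needs no evaluation of the Gauss sum:
`chirp_fourier_relation` equates two matrices, and comparing determinants gives `chirpSum_pow`. -/

namespace WeylHeisenberg

open Matrix ZMod

/-! ### Sign of negation -/

section Sign

/-- The sign of negation on `ZMod d` is `(-1) ^ ((d - 1) / 2)`. -/
theorem sign_neg (d : ℕ) [NeZero d] :
    Equiv.Perm.sign (Equiv.neg (ZMod d)) = (-1) ^ ((d - 1) / 2) := by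
  have hsq : (Equiv.neg (ZMod d) : Equiv.Perm (ZMod d)) ^ 2 = 1 := by
    ext a
    simp [pow_two]
  have hd : 0 < d := Nat.pos_of_ne_zero (NeZero.ne d)
  rw [Equiv.Perm.sign_of_pow_two_eq_one hsq]
  have hcard : Fintype.card (Function.fixedPoints (Equiv.neg (ZMod d))) =
      (Finset.univ.filter fun a : ZMod d => a = 0 ∨ 2 * a.val = d).card := by
    refine Fintype.card_of_subtype _ fun a => ?_
    simp only [Finset.mem_filter, Finset.mem_univ, true_and]
    exact (ZMod.neg_eq_self_iff a).symm
  rw [hcard, ZMod.card]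
  congr 1
  -- The fixed points are `0` and, for even `d`, also `d / 2`; the floor makes `(d - 2) / 2 = (d -
  -- 1) / 2` in the even case.
  rcases Nat.even_or_odd' d with ⟨m, hm | hm⟩
  · have hset : (Finset.univ.filter fun a : ZMod d => a = 0 ∨ 2 * a.val = d) =
        {0, (m : ZMod d)} := by
      ext a
      simp only [Finset.mem_filter, Finset.mem_univ, true_and, Finset.mem_insert,
        Finset.mem_singleton]
      refine or_congr_right ⟨fun h => ?_, fun h => ?_⟩
      · rw [← ZMod.natCast_zmod_val a]
        congr 1
        omega
      · rw [h, ZMod.val_natCast_of_lt (by omega), hm]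
    have hne : (0 : ZMod d) ≠ (m : ZMod d) := by
      intro h
      have := congrArg ZMod.val h
      rw [ZMod.val_natCast_of_lt (by omega), ZMod.val_zero] at this
      omega
    rw [hset, Finset.card_pair hne]
    omega
  · have hset : (Finset.univ.filter fun a : ZMod d => a = 0 ∨ 2 * a.val = d) = {0} := by
      ext a
      simp only [Finset.mem_filter, Finset.mem_univ, true_and, Finset.mem_singleton]
      refine ⟨fun h => h.resolve_right (by omega), Or.inl⟩
    rw [hset, Finset.card_singleton]

end Sign

/-! ### Quadratic chirps and their Gauss sum -/

section Chirp

variable (d : ℕ)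

/-- A square root `ζ = -exp (πi/d)` of `ω`, chosen such that `ζ ^ (n ^ 2)` depends only on
`n mod d`. -/
noncomputable def chirpRoot : ℂ := Complex.exp (Real.pi * Complex.I * (d + 1) / d)

theorem chirpRoot_ne_zero : chirpRoot d ≠ 0 := Complex.exp_ne_zero _

variable {d}

/-- The quadratic chirp on `ZMod d`, a square root of `a ↦ ω ^ (a ^ 2)` satisfying
`chirp (a + b) = chirp a * chirp b * ω ^ (a * b)`. -/
noncomputable def chirp (a : ZMod d) : ℂ := chirpRoot d ^ a.val ^ 2

theorem chirp_ne_zero (a : ZMod d) : chirp a ≠ 0 := pow_ne_zero _ (chirpRoot_ne_zero d)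

theorem chirp_zero : chirp (0 : ZMod d) = 1 := by simp [chirp]

variable (d) [NeZero d]

theorem chirpRoot_sq : chirpRoot d ^ 2 = omega d := by
  have hd : (d : ℂ) ≠ 0 := Nat.cast_ne_zero.2 (NeZero.ne d)
  rw [chirpRoot, omega, ← Complex.exp_nat_mul, Complex.exp_eq_exp_iff_exists_int]
  refine ⟨1, ?_⟩
  push_cast
  field_simp
  ring

theorem chirpRoot_pow_self : chirpRoot d ^ d = (-1) ^ (d + 1) := by
  have hd : (d : ℂ) ≠ 0 := Nat.cast_ne_zero.2 (NeZero.ne d)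
  rw [chirpRoot, ← Complex.exp_nat_mul, ← Complex.exp_pi_mul_I, ← Complex.exp_nat_mul]
  congr 1
  push_cast
  field_simp

/-- Both `ζ ^ (2 * d)` and `ζ ^ (d * d)` equal `1`; the second would fail for odd `d` without the
sign in `ζ = -exp (πi/d)`. -/
theorem chirpRoot_pow_mod_sq (n : ℕ) :
    chirpRoot d ^ (n % d) ^ 2 = chirpRoot d ^ n ^ 2 := by
  have hpar : ∀ m : ℕ, chirpRoot d ^ (d * (d * m)) = 1 := fun m => by
    rw [pow_mul, chirpRoot_pow_self, pow_mul, ← pow_mul (-1 : ℂ), mul_comm (d + 1),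
      (Nat.even_mul_succ_self d).neg_one_pow, one_pow]
  have hpar' : ∀ m : ℕ, chirpRoot d ^ (d * (2 * m)) = 1 := fun m => by
    rw [pow_mul, chirpRoot_pow_self, ← pow_mul, pow_mul', Even.neg_one_pow ⟨m, two_mul m⟩]
    simp
  conv_rhs => rw [← Nat.mod_add_div n d]
  rw [show (n % d + d * (n / d)) ^ 2 = (n % d) ^ 2 + d * (2 * (n % d * (n / d))) +
    d * (d * (n / d) ^ 2) by ring, pow_add, pow_add, hpar, hpar', mul_one, mul_one]

theorem stdAddChar_eq_omega_pow (a : ZMod d) : stdAddChar a = omega d ^ a.val := by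
  rw [stdAddChar_apply, toCircle_apply, omega, ← Complex.exp_nat_mul]
  congr 1
  ring

theorem omega_pow_natCast (n : ℕ) : omega d ^ n = stdAddChar (n : ZMod d) := by
  rw [show (n : ZMod d) = ((n : ℤ) : ZMod d) by simp, stdAddChar_coe, omega,
    ← Complex.exp_nat_mul]
  congr 1
  push_cast
  ring

variable {d}

theorem chirp_add (a b : ZMod d) :
    chirp (a + b) = chirp a * chirp b * stdAddChar (a * b) := by
  have : stdAddChar (a * b) = chirpRoot d ^ (2 * (a.val * b.val)) := by
    rw [pow_mul, chirpRoot_sq, omega_pow_natCast]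
    simp
  rw [this, chirp, chirp, chirp, ZMod.val_add, chirpRoot_pow_mod_sq, ← pow_add, ← pow_add]
  ring

theorem chirp_mul_self (a : ZMod d) : chirp a * chirp a = stdAddChar (a * a) := by
  rw [chirp, ← pow_two, ← pow_mul, mul_comm, pow_mul, chirpRoot_sq, omega_pow_natCast]
  simp [pow_two]

theorem stdAddChar_neg_mul_self (a : ZMod d) : stdAddChar (-a) * stdAddChar a = 1 := by
  rw [← AddChar.map_add_eq_mul, neg_add_cancel, AddChar.map_zero_eq_one]

theorem chirp_neg (a : ZMod d) : chirp (-a) = chirp a := by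
  have h := chirp_add (-a) a
  rw [neg_add_cancel, chirp_zero, neg_mul] at h
  refine mul_right_cancel₀ (chirp_ne_zero a) ?_
  rw [chirp_mul_self]
  linear_combination (-stdAddChar (a * a)) * h -
    chirp (-a) * chirp a * stdAddChar_neg_mul_self (a * a)

variable (d)

/-- The Gauss sum of the chirp. -/
noncomputable def chirpSum : ℂ := ∑ a : ZMod d, chirp a

variable {d}

/-- Completing the square: translating the Gauss sum by `k` produces the character. -/
theorem sum_chirp_mul_stdAddChar (k : ZMod d) :
    ∑ a : ZMod d, chirp a * stdAddChar (a * k) = chirpSum d / chirp k := by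
  rw [eq_div_iff (chirp_ne_zero k), chirpSum, Finset.sum_mul,
    ← Equiv.sum_comp (Equiv.addRight k) chirp]
  refine Finset.sum_congr rfl fun a _ => ?_
  rw [Equiv.coe_addRight, chirp_add]
  ring

variable (d)

/-- The unnormalized Fourier matrix. -/
noncomputable def fourierMatrix : Matrix (ZMod d) (ZMod d) ℂ := Matrix.of fun a b => stdAddChar (a * b)

theorem sum_stdAddChar_mul (b : ZMod d) :
    ∑ a : ZMod d, stdAddChar (a * b) = if b = 0 then (d : ℂ) else 0 := by
  rw [AddChar.sum_mulShift b (isPrimitive_stdAddChar d), ZMod.card]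
  push_cast
  rfl

theorem fourierMatrix_mul_self : fourierMatrix d * fourierMatrix d =
    (d : ℂ) • (Equiv.neg (ZMod d)).permMatrix ℂ := by
  ext a b
  simp only [fourierMatrix, Matrix.mul_apply, Matrix.of_apply, Matrix.smul_apply,
    ← AddChar.map_add_eq_mul, Equiv.Perm.permMatrix, PEquiv.toMatrix_apply]
  rw [show ∑ x : ZMod d, stdAddChar (a * x + x * b) = ∑ x : ZMod d, stdAddChar (x * (a + b)) from
    Finset.sum_congr rfl fun x _ => by ring_nf, sum_stdAddChar_mul]
  simp [neg_eq_iff_add_eq_zero]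

/-- The braid-type relation between chirp multiplication and the Fourier transform; entrywise it is
completion of the square. Its determinant brings in `g ^ d`. -/
theorem chirp_fourier_relation :
    Matrix.diagonal chirp * fourierMatrix d * Matrix.diagonal chirp * fourierMatrix d *
      Matrix.diagonal chirp =
    chirpSum d • ((Equiv.neg (ZMod d)).permMatrix ℂ * fourierMatrix d) := by
  ext a b
  rw [Matrix.mul_diagonal, Matrix.mul_apply]
  simp only [Matrix.mul_diagonal, Matrix.diagonal_mul, Matrix.smul_apply, fourierMatrix,
    Matrix.of_apply, Equiv.Perm.permMatrix, PEquiv.toMatrix_toPEquiv_mul, Matrix.submatrix_apply,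
    Equiv.neg_apply, id, neg_mul, smul_eq_mul]
  have h := sum_chirp_mul_stdAddChar (a + b)
  rw [eq_div_iff (chirp_ne_zero _), chirp_add, Finset.sum_mul] at h
  rw [← h, Finset.sum_mul, Finset.sum_mul]
  refine Finset.sum_congr rfl fun x _ => ?_
  rw [show x * (a + b) = a * x + x * b by ring, AddChar.map_add_eq_mul]
  linear_combination (-chirp a * chirp b * chirp x * stdAddChar (a * x) * stdAddChar (x * b)) *
    stdAddChar_neg_mul_self (a * b)

theorem six_mul_sum_range_sq (n : ℕ) :
    6 * ∑ i ∈ Finset.range n, i ^ 2 = n * ((n - 1) * (2 * n - 1)) := by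
  induction n with
  | zero => simp
  | succ n ih =>
    rw [Finset.sum_range_succ, mul_add, ih]
    rcases n with _ | n
    · rfl
    · simp only [Nat.add_sub_cancel, show 2 * (n + 1) - 1 = 2 * n + 1 by omega,
        show 2 * (n + 1 + 1) - 1 = 2 * n + 3 by omega]
      ring

theorem sum_val_sq : ∑ a : ZMod d, a.val ^ 2 = ∑ i ∈ Finset.range d, i ^ 2 := by
  rcases d with _ | n
  · exact absurd rfl (NeZero.ne 0)
  · exact Fin.sum_univ_eq_sum_range (fun i => i ^ 2) (n + 1)

/-- The sixth power clears the denominator in the formula for the sum of squares. -/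
theorem prod_chirp_pow_six : (∏ a : ZMod d, chirp a) ^ 6 = (-1) ^ (d + 1) := by
  simp only [chirp]
  rw [Finset.prod_pow_eq_pow_sum, ← pow_mul, mul_comm, sum_val_sq, six_mul_sum_range_sq, pow_mul,
    chirpRoot_pow_self, ← pow_mul]
  have hd : 0 < d := Nat.pos_of_ne_zero (NeZero.ne d)
  rcases Nat.even_or_odd' d with ⟨m, hm | hm⟩
  · have h1 : Odd (d + 1) := ⟨m, by omega⟩
    have h2 : Odd (d - 1) := ⟨m - 1, by omega⟩
    have h3 : Odd (2 * d - 1) := ⟨d - 1, by omega⟩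
    rw [h1.neg_one_pow, (h1.mul (h2.mul h3)).neg_one_pow]
  · have h1 : Even (d + 1) := ⟨m + 1, by omega⟩
    rw [h1.neg_one_pow, (h1.mul_right _).neg_one_pow]

/-- The Gauss sum of the chirp satisfies `(g / √d) ^ (2 d) = (-1) ^ (d (d - 1) / 2)`. -/
theorem chirpSum_pow : chirpSum d ^ (2 * d) = (-1) ^ (d * (d - 1) / 2) * (d : ℂ) ^ d := by
  have hd0 : (d : ℂ) ≠ 0 := Nat.cast_ne_zero.2 (NeZero.ne d)
  have hd : 0 < d := Nat.pos_of_ne_zero (NeZero.ne d)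
  have hF := congrArg Matrix.det (fourierMatrix_mul_self d)
  have hR := congrArg Matrix.det (chirp_fourier_relation d)
  have hD := prod_chirp_pow_six d
  simp only [Matrix.det_mul, Matrix.det_smul, Matrix.det_diagonal, Matrix.det_permutation,
    ZMod.card, sign_neg] at hF hR
  push_cast at hF hR
  set P := ∏ a : ZMod d, chirp a
  set F := (fourierMatrix d).det
  set s : ℂ := (-1) ^ ((d - 1) / 2)
  have hs : s * s = 1 := by
    rw [← pow_add, Even.neg_one_pow ⟨_, rfl⟩]
  have hs0 : s ≠ 0 := left_ne_zero_of_mul_eq_one hs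
  have hF0 : F ≠ 0 := by
    intro h
    rw [h, mul_zero] at hF
    exact mul_ne_zero (pow_ne_zero _ hd0) hs0 hF.symm
  -- Squaring this identity turns `F` into `F ^ 2`, which `hF` evaluates, and `P ^ 3` into `P ^ 6`.
  have hR' : P ^ 3 * F = chirpSum d ^ d * s := by
    refine mul_right_cancel₀ hF0 ?_
    linear_combination hR
  have hmain : chirpSum d ^ (2 * d) = (-1) ^ (d + 1) * s * (d : ℂ) ^ d := by
    rw [mul_comm 2 d, pow_mul, ← hD]
    linear_combination (-(P ^ 3 * F + chirpSum d ^ d * s)) * hR' + P ^ 6 * hF -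
      (chirpSum d ^ d) ^ 2 * hs
  rw [hmain]
  congr 1
  rw [← pow_add]
  rcases Nat.even_or_odd' d with ⟨m, hm | hm⟩
  · obtain ⟨m, rfl⟩ : ∃ k, m = k + 1 := ⟨m - 1, by omega⟩
    have h1 : d * (d - 1) / 2 = (m + 1) * (2 * m + 1) := by
      rw [hm, show 2 * (m + 1) - 1 = 2 * m + 1 by omega, mul_assoc]
      exact Nat.mul_div_cancel_left _ two_pos
    rw [h1, show d + 1 + (d - 1) / 2 = m + 1 + 2 * (m + 1) by omega,
      show (m + 1) * (2 * m + 1) = m + 1 + 2 * (m * (m + 1)) by ring]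
    simp [pow_add, pow_mul]
  · have h1 : d * (d - 1) / 2 = (2 * m + 1) * m := by
      rw [hm, show 2 * m + 1 - 1 = 2 * m by omega, mul_left_comm]
      exact Nat.mul_div_cancel_left _ two_pos
    rw [h1, show d + 1 + (d - 1) / 2 = m + 2 * (m + 1) by omega,
      show (2 * m + 1) * m = m + 2 * (m * m) by ring]
    simp [pow_add, pow_mul]

end Chirp

/-! ### Powers of the reconstruction operator -/

section Reconstruction

variable (d : ℕ) [NeZero d]

theorem shift_pow_apply (n : ℕ) (a b : ZMod d) :
    (shift d ^ n) a b = if a = b + n then 1 else 0 := by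
  induction n generalizing a with
  | zero => simp [Matrix.one_apply]
  | succ n ih =>
    rw [pow_succ', Matrix.mul_apply, Finset.sum_eq_single (b + n)]
    · rw [ih, if_pos rfl, mul_one, shift, Matrix.of_apply]
      push_cast
      rw [add_assoc]
    · intro c _ hc
      rw [ih, if_neg hc, mul_zero]
    · simp

theorem rho_apply (j k a b : ZMod d) :
    rho d (j, k) a b = if a = b + j then stdAddChar (k * b) else 0 := by
  rw [rho, modulation, Matrix.diagonal_pow, Matrix.mul_diagonal, shift_pow_apply]
  simp only [ZMod.natCast_val, ZMod.cast_id', id, Pi.pow_apply, ite_mul, one_mul, zero_mul]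
  rw [← stdAddChar_eq_omega_pow, ← AddChar.map_nsmul_eq_pow, nsmul_eq_mul, ZMod.natCast_val,
    ZMod.cast_id', id]

theorem star_stdAddChar (a : ZMod d) : star (stdAddChar a) = stdAddChar (-a) := by
  rw [AddChar.map_neg_eq_conj]
  rfl

theorem reconstruction_apply (c : Matrix (ZMod d) (ZMod d) ℂ) (a b : ZMod d) :
    reconstruction d c a b = (1 / (d : ℂ)) * ∑ k, c (b - a) k * stdAddChar (-(k * a)) := by
  change ((1 / (d : ℂ)) • ∑ j : ZMod d, ∑ k : ZMod d, c j k • (rho d (j, k))ᴴ) a b = _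
  simp only [Matrix.smul_apply, Matrix.sum_apply, Matrix.conjTranspose_apply, rho_apply,
    smul_eq_mul]
  congr 1
  rw [Finset.sum_eq_single (b - a)]
  · simp [star_stdAddChar]
  · intro j _ hj
    refine Finset.sum_eq_zero fun k _ => ?_
    rw [if_neg, star_zero, mul_zero]
    rintro rfl
    simp at hj
  · simp

/-- The cube of the reconstruction operator reduces to a single sum. -/
theorem reconstruction_cube_apply (c : Matrix (ZMod d) (ZMod d) ℂ) (a b : ZMod d) :
    (reconstruction d ^ 3) c a b =
      (1 / (d : ℂ)) ^ 2 * ∑ p, c p (-b) * stdAddChar (-((b - a) * (a + p))) := by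
  have hd0 : (d : ℂ) ≠ 0 := Nat.cast_ne_zero.2 (NeZero.ne d)
  rw [pow_succ', pow_two, Module.End.mul_apply, Module.End.mul_apply]
  simp only [reconstruction_apply]
  -- The phase is affine in `n` with slope `-(b + m)`, so orthogonality of characters forces `m =
  -- -b`.
  have hinner : ∀ p m : ZMod d,
      ∑ n : ZMod d, stdAddChar (-((n + b - a) * a) + -((p + n) * (b - a)) + -(m * n)) =
        if m = -b then d * stdAddChar (-((b - a) * (a + p))) else 0 := by
    intro p m
    have : ∀ n : ZMod d, stdAddChar (-((n + b - a) * a) + -((p + n) * (b - a)) + -(m * n)) =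
        stdAddChar (-((b - a) * (a + p))) * stdAddChar (n * (-(b + m))) := fun n => by
      rw [← AddChar.map_add_eq_mul]
      ring_nf
    simp only [this, ← Finset.mul_sum, sum_stdAddChar_mul]
    have hiff : -(b + m) = 0 ↔ m = -b := by
      rw [neg_eq_zero, add_comm, add_eq_zero_iff_eq_neg]
    simp only [hiff]
    split_ifs <;> ring
  calc _ = (1 / (d : ℂ)) ^ 3 * ∑ k, ∑ l, ∑ m, c (l - (k - (b - a))) m *
        stdAddChar (-(k * a) + -(l * (b - a)) + -(m * (k - (b - a)))) := by
        simp only [Finset.mul_sum, Finset.sum_mul, AddChar.map_add_eq_mul]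
        refine Finset.sum_congr rfl fun k _ => Finset.sum_congr rfl fun l _ =>
          Finset.sum_congr rfl fun m _ => ?_
        ring
    _ = (1 / (d : ℂ)) ^ 3 * ∑ n, ∑ p, ∑ m, c p m *
        stdAddChar (-((n + b - a) * a) + -((p + n) * (b - a)) + -(m * n)) := by
        congr 1
        -- Substitute `k = n + (b - a)` and `l = p + n`.
        rw [← Equiv.sum_comp (Equiv.addRight (b - a))]
        refine Finset.sum_congr rfl fun n _ => ?_
        rw [← Equiv.sum_comp (Equiv.addRight n)]
        refine Finset.sum_congr rfl fun p _ => Finset.sum_congr rfl fun m _ => ?_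
        simp only [Equiv.coe_addRight, add_sub_cancel_right]
        rw [add_sub_assoc]
    _ = (1 / (d : ℂ)) ^ 3 * ∑ p, ∑ m, c p m *
        (if m = -b then d * stdAddChar (-((b - a) * (a + p))) else 0) := by
        congr 1
        rw [Finset.sum_comm]
        refine Finset.sum_congr rfl fun p _ => ?_
        rw [Finset.sum_comm]
        refine Finset.sum_congr rfl fun m _ => ?_
        rw [← Finset.mul_sum, hinner]
    _ = _ := by
        simp only [mul_ite, mul_zero, Finset.sum_ite_eq', Finset.mem_univ, if_true,
          Finset.mul_sum]
        refine Finset.sum_congr rfl fun p _ => ?_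
        field_simp

/-- The modulated chirps `a ↦ chirp a * ω ^ (k * a)`, with column `b` scaled by `f b`. -/
noncomputable def chirpPacket {d : ℕ} [NeZero d] (k : ZMod d) (f : ZMod d → ℂ) : Matrix (ZMod d) (ZMod d) ℂ :=
  Matrix.of fun a b => f b * (chirp a * stdAddChar (k * a))

/-- The sum over `p` is a modulated Gauss sum, giving `1 / chirp (k - b + a)`; the phase `ω ^ (a ^
2) = chirp a ^ 2` outside it restores `chirp a`. -/
theorem reconstruction_cube_chirpPacket (k : ZMod d) (f : ZMod d → ℂ) :
    (reconstruction d ^ 3) (chirpPacket k f) =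
      chirpPacket (-k) fun b => (1 / (d : ℂ)) ^ 2 * chirpSum d * f (-b) / chirp (k - b) := by
  ext a b
  rw [reconstruction_cube_apply]
  simp only [chirpPacket, Matrix.of_apply]
  have hsum : ∑ p, f (-b) * (chirp p * stdAddChar (k * p)) * stdAddChar (-((b - a) * (a + p))) =
      f (-b) * stdAddChar (-((b - a) * a)) * (chirpSum d / chirp (k - b + a)) := by
    rw [← sum_chirp_mul_stdAddChar, Finset.mul_sum]
    refine Finset.sum_congr rfl fun p _ => ?_
    have : stdAddChar (k * p) * stdAddChar (-((b - a) * (a + p))) =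
        stdAddChar (-((b - a) * a)) * stdAddChar (p * (k - b + a)) := by
      rw [← AddChar.map_add_eq_mul, ← AddChar.map_add_eq_mul]
      ring_nf
    linear_combination f (-b) * chirp p * this
  have hchar : stdAddChar (-((b - a) * a)) =
      chirp a * chirp a * (stdAddChar (-k * a) * stdAddChar ((k - b) * a)) := by
    rw [chirp_mul_self, ← AddChar.map_add_eq_mul, ← AddChar.map_add_eq_mul]
    ring_nf
  have h1 := chirp_ne_zero (k - b)
  have h2 := chirp_ne_zero a
  have h3 : stdAddChar ((k - b) * a) ≠ 0 :=
    right_ne_zero_of_mul_eq_one (stdAddChar_neg_mul_self _)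
  rw [hsum, hchar, chirp_add]
  field_simp

theorem reconstruction_pow_six_chirpPacket (k : ZMod d) (f : ZMod d → ℂ) :
    (reconstruction d ^ 6) (chirpPacket k f) =
      chirpPacket k fun b => (1 / (d : ℂ)) ^ 4 * chirpSum d ^ 2 * f b *
        stdAddChar (-((k + b) * (k + b))) := by
  rw [show 6 = 3 + 3 from rfl, pow_add, Module.End.mul_apply, reconstruction_cube_chirpPacket,
    reconstruction_cube_chirpPacket, neg_neg]
  congr 1
  ext b
  have h := chirp_ne_zero (k + b)
  have hE := stdAddChar_neg_mul_self ((k + b) * (k + b))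
  rw [← chirp_mul_self] at hE
  rw [neg_neg, sub_neg_eq_add, show -k - b = -(k + b) by ring, chirp_neg]
  field_simp
  linear_combination (-(chirpSum d ^ 2 * f b * (d : ℂ)⁻¹ ^ 4)) * hE

theorem reconstruction_pow_six_mul_chirpPacket (n : ℕ) (k : ZMod d) (f : ZMod d → ℂ) :
    (reconstruction d ^ (6 * n)) (chirpPacket k f) =
      chirpPacket k fun b => ((1 / (d : ℂ)) ^ 4 * chirpSum d ^ 2) ^ n * f b *
        stdAddChar (-((k + b) * (k + b))) ^ n := by
  induction n with
  | zero => simp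
  | succ n ih =>
    rw [Nat.mul_succ, add_comm, pow_add, Module.End.mul_apply, ih,
      reconstruction_pow_six_chirpPacket]
    congr 1
    ext b
    ring

/-- Fourier inversion of each column after dividing it by the chirp. -/
theorem exists_sum_chirpPacket (c : Matrix (ZMod d) (ZMod d) ℂ) :
    ∃ f : ZMod d → ZMod d → ℂ, c = ∑ k, chirpPacket k (f k) := by
  have hd0 : (d : ℂ) ≠ 0 := Nat.cast_ne_zero.2 (NeZero.ne d)
  refine ⟨fun k b => (1 / (d : ℂ)) * ∑ x, c x b / chirp x * stdAddChar (-(k * x)), ?_⟩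
  ext a b
  simp only [Matrix.sum_apply, chirpPacket, Matrix.of_apply, Finset.mul_sum, Finset.sum_mul]
  have : ∀ x, ∑ k, 1 / (d : ℂ) * (c x b / chirp x * stdAddChar (-(k * x))) *
      (chirp a * stdAddChar (k * a)) = if x = a then c a b else 0 := by
    intro x
    have hk : ∀ k, 1 / (d : ℂ) * (c x b / chirp x * stdAddChar (-(k * x))) *
        (chirp a * stdAddChar (k * a)) =
        1 / (d : ℂ) * (c x b / chirp x) * chirp a * stdAddChar (k * (a - x)) := fun k => by
      rw [show k * (a - x) = -(k * x) + k * a by ring, AddChar.map_add_eq_mul]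
      ring
    simp only [hk, ← Finset.mul_sum, sum_stdAddChar_mul, sub_eq_zero, eq_comm (a := a)]
    have := chirp_ne_zero a
    split_ifs with h
    · subst h
      field_simp
    · rw [mul_zero]
  rw [Finset.sum_comm, Finset.sum_congr rfl fun x _ => this x]
  simp

theorem sqrt_smul_reconstruction_pow :
    ((Real.sqrt d : ℂ) • reconstruction d) ^ (6 * d) =
      ((-1 : ℂ) ^ (d * (d - 1) / 2)) • (1 : Module.End ℂ (Matrix (ZMod d) (ZMod d) ℂ)) := by
  have hd0 : (d : ℂ) ≠ 0 := Nat.cast_ne_zero.2 (NeZero.ne d)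
  have hsqrt : (Real.sqrt d : ℂ) ^ 2 = d := by
    exact_mod_cast Real.sq_sqrt (Nat.cast_nonneg d)
  -- The powers of `d` cancel: `3d` from the square root, `-4d` from the sixth power of the
  -- operator, `d` from the Gauss sum.
  have hscalar : (Real.sqrt d : ℂ) ^ (6 * d) * ((1 / (d : ℂ)) ^ 4 * chirpSum d ^ 2) ^ d =
      (-1) ^ (d * (d - 1) / 2) := by
    rw [mul_pow _ _ d, ← pow_mul (chirpSum d), chirpSum_pow, show 6 * d = 2 * (3 * d) by ring,
      pow_mul, hsqrt, ← pow_mul, one_div, inv_pow]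
    field_simp
    ring
  refine LinearMap.ext fun c => ?_
  obtain ⟨f, rfl⟩ := exists_sum_chirpPacket d c
  rw [map_sum, map_sum]
  refine Finset.sum_congr rfl fun k _ => ?_
  rw [smul_pow, LinearMap.smul_apply, LinearMap.smul_apply, Module.End.one_apply,
    reconstruction_pow_six_mul_chirpPacket, ← hscalar]
  ext a b
  have hE : stdAddChar (-((k + b) * (k + b))) ^ d = 1 := by
    rw [← AddChar.map_nsmul_eq_pow, nsmul_eq_mul, ZMod.natCast_self, zero_mul,
      AddChar.map_zero_eq_one]
  simp only [Matrix.smul_apply, chirpPacket, Matrix.of_apply, smul_eq_mul, hE]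
  ring

end Reconstruction

end WeylHeisenberg

theorem theorem3p2 (d : ℕ) [NeZero d] (hd : 2 ≤ d) :
    IsOfFinOrder ((Real.sqrt d : ℂ) • WeylHeisenberg.reconstruction d) ∧
    ((Real.sqrt d : ℂ) • WeylHeisenberg.reconstruction d) ^ (6 * d) =
      ((-1 : ℂ) ^ (d * (d - 1) / 2)) •
        (1 : Module.End ℂ (Matrix (ZMod d) (ZMod d) ℂ)) := by
  have h := WeylHeisenberg.sqrt_smul_reconstruction_pow d
  -- Doubling the exponent removes the sign.
  refine ⟨isOfFinOrder_iff_pow_eq_one.2 ⟨6 * d * 2, by omega, ?_⟩, h⟩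
  rw [pow_mul, h, smul_pow, one_pow, ← pow_mul, pow_mul', neg_one_sq, one_pow, one_smul]
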